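/- **Setting.** Finitely many clients $c\in C$ hold data sets $d_c=(x_i)_{i\in I_c}$, $I_c$ finite. Fix a clipping norm $L>0$ and a noise level $\sigma>0$, the same for all clients, and let $\mathrm{clip}_L(g)=g/\max(1,\|g\|_2/L)$ for $g\in\mathbb R^p$. In each round $t=0,1,2,\dots$ each client, independently of the other clients and of the past, draws a mini-batch $J\subseteq I_c$ from a sampling law $\pi_c$ that does not depend on the data, and releases $$ q+\mathcal N\Bigl(0,\frac{\sigma^2L^2 I}{n^{(c)}}\Bigr),\qquad n^{(c)}=|J| ,$$ where $q$ is the clipped gradient on the mini-batch (a client with $J=\emptyset$, in particular one that does not take part in the round, contributes $0$). The gradients may depend measurably on everything that all clients released in earlier rounds, and on the client's own mini-batch, but not directly on the data of the other clients. Suppose that every non-empty mini-batch that client $c$ draws with positive probability has size between $m_c\ge 1$ and $n_c$. Two readings of the clipping are considered: (a) $q=\mathrm{clip}_L(g^{(c)})$ for an arbitrary gradient $g^{(c)}$ of the mini-batch; then put $r_c=n_c$. (b) $q=\frac1{n^{(c)}}\sum_{i\in J}\mathrm{clip}_L(g(x_i))$ with per-example gradients $g(x_i)$; then put $r_c=1/m_c$.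 Data sets of one client are adjacent if they differ in at most one example (replacement); in the distributed environment, collections $(d_c)_{c\in C}$ are adjacent if the data of one client are changed to an adjacent data set and all others are equal. A mechanism $M$ is $(\varepsilon,\delta)$-differentially private if $\Pr[M(d)\in S]\le e^{\varepsilon}\Pr[M(d')\in S]+\delta$ for all adjacent $d,d'$ and measurable $S$. The moments accountant tracks $$\alpha_M(\lambda)=\sup_{a,\;d\sim d'}\log \mathbb E_{o\sim M(a,d)}\Bigl[\Bigl(\tfrac{\mathrm dM(a,d)}{\mathrm dM(a,d')}(o)\Bigr)^{\lambda}\Bigr],\qquad \lambda>0,$$ where $a$ runs over the auxiliary inputs (for a round: all earlier releases). **Theorem.** Let $\alpha_{c,t}$ belong to the update of client $c$ in round $t$ (including the sampling of the mini-batch), and $\alpha_t$ to the joint update of all clients in round $t$. In both cases (a) and (b), for all $\lambda>0$, all $c$, all $t$, and all numbers of rounds $T$: 1. $\alpha_{c,t}(\lambda)\le 2r_c\lambda(\lambda+1)/\sigma^2$. 2. (Parallel composition) $\alpha_t(\lambda)=\sup_c\alpha_{c,t}(\lambda)$. 3. (Composition over rounds) The transcript of $T$ rounds (the updates of all clients),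 as a mechanism on the data of client $c$ with the other clients' data as auxiliary input, has log moments at most $\sum_{t<T}\alpha_{c,t}(\lambda)$; as a mechanism on the data of all clients, it has log moments at most $\sum_{t<T}\alpha_t(\lambda)$. 4. (Differential privacy) For every $\varepsilon\in\mathbb R$ the transcript of $T$ rounds is $(\varepsilon,\delta)$-differentially private for client $c$, whatever the data of the other clients, with $\delta=\inf_{\lambda>0}\exp\bigl(\sum_{t<T}\alpha_{c,t}(\lambda)-\lambda\varepsilon\bigr)$, and it is $(\varepsilon,\delta)$-differentially private in the distributed environment with $\delta=\inf_{\lambda>0}\exp\bigl(\sum_{t<T}\sup_c\alpha_{c,t}(\lambda)-\lambda\varepsilon\bigr)$. 5. In particular, for every $\delta\in(0,1)$, the transcript of $T$ rounds is $\bigl(\rho+2\sqrt{\rho\log(1/\delta)},\,\delta\bigr)$-differentially private for client $c$ with $\rho=2r_cT/\sigma^2$, and in the distributed environment for every $\rho$ with $\rho\ge 2r_cT/\sigma^2$ for all $c$. -/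

import Mathlib

open MeasureTheory ProbabilityTheory
open scoped ENNReal

noncomputable section

/-! ## Differential privacy and the moments accountant -/

/-- `(ε, δ)`-differential privacy of a randomized mechanism `M` (a data set is mapped to the law of
the output) with respect to the adjacency relation `adj` on data sets. -/
def IsDP {D O : Type*} [MeasurableSpace O] (adj : D → D → Prop) (M : D → Measure O)
    (ε : ℝ) (δ : ℝ≥0∞) : Prop :=
  ∀ d d' : D, adj d d' → ∀ S : Set O, MeasurableSet S →
    M d S ≤ ENNReal.ofReal (Real.exp ε) * M d' S + δ

/-- The logarithm of the moment generating function, at `lam`, of the privacy loss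
`log (dP/dQ)(o)`, `o ∼ P`, that is `log E_{o ∼ P} [(dP/dQ)(o) ^ lam]`
(the privacy loss is infinite with positive probability when `P` is not dominated by `Q`). -/
def logMoment {O : Type*} [MeasurableSpace O] (P Q : Measure O) (lam : ℝ) : EReal :=
  open Classical in
  if P ≪ Q then ENNReal.log (∫⁻ o, (P.rnDeriv Q o) ^ lam ∂P) else ⊤

/-- The quantity tracked by the moments accountant for a mechanism `M` with auxiliary input:
`α_M(lam) = sup` of the log moment of the privacy loss over all auxiliary inputs and all pairs of
adjacent data sets. -/
def momentBound {A D O : Type*} [MeasurableSpace O] (adj : D → D → Prop)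
    (M : A → D → Measure O) (lam : ℝ) : EReal :=
  ⨆ (a : A) (d : D) (d' : D) (_ : adj d d'), logMoment (M a d) (M a d') lam

/-- The `δ` which the moments accountant reports at `ε` when the accumulated log moments are `α`:
`δ = inf_{lam > 0} exp (α(lam) - lam ε)`. -/
def accountantDelta (α : ℝ → EReal) (ε : ℝ) : ℝ≥0∞ :=
  ⨅ (lam : ℝ) (_ : 0 < lam), EReal.exp (α lam - ((lam * ε : ℝ) : EReal))

/-- Two data sets with the same index set are adjacent if they differ in at most one example. -/
def ExampleAdj {ι X : Type*} (d d' : ι → X) : Prop :=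
  ∃ i, ∀ j, j ≠ i → d j = d' j

/-- Adjacency in the distributed environment: one example of one client is changed. -/
def DistributedAdj {C : Type*} {ι : C → Type*} {X : Type*} (D D' : ∀ c, ι c → X) : Prop :=
  ∃ c, ExampleAdj (D c) (D' c) ∧ ∀ c', c' ≠ c → D c' = D' c'

/-! ## The client update rule -/

/-- Gradients of the shared (shallow) model with `p` parameters, with the `ℓ₂` norm. -/
abbrev Grad (p : ℕ) : Type := EuclideanSpace ℝ (Fin p)

/-- Everything released in the first `t` rounds: the noisy gradients of all clients. -/
abbrev History (C : Type*) (p t : ℕ) : Type _ := Fin t → C → Grad p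

/-- Gradient clipping `g / max (1, ‖g‖₂ / L)`. -/
def clip {p : ℕ} (L : ℝ) (g : Grad p) : Grad p := (max 1 (‖g‖ / L))⁻¹ • g

/-- The Gaussian noise step for the sampled mini-batch `J` of size `n = #J`: the law of
`v + N(0, σ² L² I / n)`. A client with an empty batch (in particular one that is not selected in
this round) contributes nothing, recorded as the zero update. -/
def noisyUpdate {ι : Type*} {p : ℕ} (σ L : ℝ) (J : Finset ι) (v : Grad p) : Measure (Grad p) :=
  open Classical in
  if J = ∅ then Measure.dirac 0
  else multivariateGaussian v ((σ ^ 2 * L ^ 2 / (J.card : ℝ)) • (1 : Matrix (Fin p) (Fin p) ℝ))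

/-- The law of a client's update: draw a mini-batch `J` from the sampling law `π`, then release
`q J + N(0, σ² L² I / #J)`, where `q J` is the clipped gradient on the mini-batch `J`. -/
def clientLaw {ι : Type*} [Fintype ι] {p : ℕ} (σ L : ℝ) (π : PMF (Finset ι))
    (q : Finset ι → Grad p) : Measure (Grad p) :=
  ∑ J : Finset ι, π J • noisyUpdate σ L J (q J)

section Federated

variable {C : Type*} {ι : C → Type*} {X : Type*} {p : ℕ}

/-- A query: the clipped (not yet noisy) gradient of client `c` in round `t`, as a function of
everything released before round `t`, of the data of client `c` and of the sampled mini-batch. -/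
abbrev Query (C : Type*) (ι : C → Type*) (X : Type*) (p : ℕ) : Type _ :=
  ∀ t : ℕ, History C p t → ∀ c : C, (ι c → X) → Finset (ι c) → Grad p

/-- The rule as written: the gradient `G t h c J x` of client `c` on its mini-batch
`x = (x_i)_{i ∈ J}` is clipped to norm `L`. -/
def clippedGradient (L : ℝ)
    (G : ∀ t : ℕ, History C p t → ∀ c : C, ∀ J : Finset (ι c), (J → X) → Grad p) :
    Query C ι X p :=
  fun t h c d J => clip L (G t h c J (fun i => d i))

/-- Per-example clipping: the average over the mini-batch of the clipped gradients of the single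
examples. -/
def averagedClippedGradients (L : ℝ)
    (g : ∀ t : ℕ, History C p t → C → X → Grad p) : Query C ι X p :=
  fun t h c d J => (J.card : ℝ)⁻¹ • ∑ i ∈ J, clip L (g t h c (d i))

variable [∀ c, Fintype (ι c)]

/-- The update rule of client `c` in round `t` as a mechanism on the data of client `c`, the
auxiliary input being everything released before. -/
def clientMech (σ L : ℝ) (π : ∀ c, PMF (Finset (ι c))) (Q : Query C ι X p) (t : ℕ) (c : C)
    (h : History C p t) (d : ι c → X) : Measure (Grad p) :=
  clientLaw σ L (π c) (Q t h c d)

variable [Fintype C]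

/-- One round of the distributed mechanism: all clients apply their update rule to their own data,
independently of each other. -/
def roundMech (σ L : ℝ) (π : ∀ c, PMF (Finset (ι c))) (Q : Query C ι X p) (t : ℕ)
    (h : History C p t) (D : ∀ c, ι c → X) : Measure (C → Grad p) :=
  Measure.pi fun c => clientMech σ L π Q t c h (D c)

/-- The law of everything released in the first `T` rounds. -/
def transcript (σ L : ℝ) (π : ∀ c, PMF (Finset (ι c))) (Q : Query C ι X p)
    (D : ∀ c, ι c → X) : (T : ℕ) → Measure (History C p T)
  | 0 => Measure.dirac Fin.elim0
  | t + 1 => (transcript σ L π Q D t).bind fun h =>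
      (roundMech σ L π Q t h D).map fun o => Fin.snoc (α := fun _ => C → Grad p) h o

variable [DecidableEq C]

/-- The update rule with clipped gradients `Q` satisfies differential privacy, for each client and
in the distributed environment, and its privacy loss is tracked by the moments accountant; `r c`
determines the size of the privacy loss of client `c`. -/
structure PrivateAndTracked (σ L : ℝ) (π : ∀ c, PMF (Finset (ι c))) (Q : Query C ι X p)
    (r : C → ℝ) : Prop where
  /-- The log moments of one application of the rule by one client are finite. -/
  client_round : ∀ (t : ℕ) (c : C) (lam : ℝ), 0 < lam →
    momentBound ExampleAdj (clientMech σ L π Q t c) lam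
      ≤ ((2 * r c * lam * (lam + 1) / σ ^ 2 : ℝ) : EReal)
  /-- In one round, the loss of all clients together is the largest loss of a single client. -/
  distributed_round : ∀ (t : ℕ) (lam : ℝ), 0 < lam →
    momentBound DistributedAdj (roundMech σ L π Q t) lam
      = ⨆ c, momentBound ExampleAdj (clientMech σ L π Q t c) lam
  /-- Over the rounds, the log moments of a client add up. All data of the other clients are
  auxiliary input, and the updates of all clients are visible. -/
  client_composition : ∀ (c : C) (T : ℕ) (lam : ℝ), 0 < lam →
    momentBound ExampleAdj
        (fun (D : ∀ c, ι c → X) d => transcript σ L π Q (Function.update D c d) T) lam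
      ≤ ∑ t ∈ Finset.range T, momentBound ExampleAdj (clientMech σ L π Q t c) lam
  /-- Over the rounds, the log moments of the distributed mechanism add up. -/
  distributed_composition : ∀ (T : ℕ) (lam : ℝ), 0 < lam →
    momentBound DistributedAdj (fun (_ : Unit) D => transcript σ L π Q D T) lam
      ≤ ∑ t ∈ Finset.range T, momentBound DistributedAdj (roundMech σ L π Q t) lam
  /-- Each client has the differential privacy which the accountant reports. -/
  client_dp : ∀ (c : C) (T : ℕ) (D : ∀ c, ι c → X) (ε : ℝ),
    IsDP ExampleAdj (fun d => transcript σ L π Q (Function.update D c d) T) ε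
      (accountantDelta (fun lam => ∑ t ∈ Finset.range T,
        momentBound ExampleAdj (clientMech σ L π Q t c) lam) ε)
  /-- The distributed mechanism has the differential privacy which the accountant reports. -/
  distributed_dp : ∀ (T : ℕ) (ε : ℝ),
    IsDP DistributedAdj (fun D => transcript σ L π Q D T) ε
      (accountantDelta (fun lam => ∑ t ∈ Finset.range T,
        ⨆ c, momentBound ExampleAdj (clientMech σ L π Q t c) lam) ε)
  /-- Explicit `(ε, δ)`-differential privacy of each client, for every `δ`. -/
  client_dp_explicit : ∀ (c : C) (T : ℕ) (D : ∀ c, ι c → X) (ρ δ : ℝ),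
    ρ = 2 * r c * T / σ ^ 2 → 0 < δ → δ < 1 →
    IsDP ExampleAdj (fun d => transcript σ L π Q (Function.update D c d) T)
      (ρ + 2 * Real.sqrt (ρ * Real.log (1 / δ))) (ENNReal.ofReal δ)
  /-- Explicit `(ε, δ)`-differential privacy of the distributed mechanism, for every `δ`. -/
  distributed_dp_explicit : ∀ (T : ℕ) (ρ δ : ℝ),
    (∀ c, 2 * r c * T / σ ^ 2 ≤ ρ) → 0 < δ → δ < 1 →
    IsDP DistributedAdj (fun D => transcript σ L π Q D T)
      (ρ + 2 * Real.sqrt (ρ * Real.log (1 / δ))) (ENNReal.ofReal δ)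

end Federated

end

/-! The accountant works with the exponential moments `E_P [(dP/dQ) ^ lam]` of the privacy loss,
written as `∫ f ^ (lam + 1) dQ` for a density `f` of `P` with respect to `Q`
(`HasDensityMoment`). In this form

* they multiply over independent components (`HasDensityMoment.pi`), so in a round the clients
  whose data agree contribute the factor `1`;
* they are convex under mixtures (`HasDensityMoment.mixture`), so the random mini-batch costs
  nothing beyond its worst value;
* a second mechanism whose conditional moments are at most `M`, whatever the first one released,
  multiplies the moment by at most `M` (`HasDensityMoment.compProd`), so logarithms add up over
  the rounds (`logMoment_transcript_le`);
* by Markov's inequality they bound the probability that the density exceeds `exp ε`, which is the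
  `δ` of `(ε, δ)`-differential privacy (`HasDensityMoment.measure_le`).

For normal laws with means `u`, `w` and covariance `v I` the moment is
`exp (lam (lam + 1) ‖u - w‖² / (2 v))`. Here `v = σ² L² / #J`, and `‖u - w‖` is at most `2 L` if the
gradient of the batch is clipped, and at most `2 L / #J` if the gradients of the examples are clipped
and averaged. Hence the log moment is at most `2 #J lam (lam + 1) / σ²` in the first case and
`2 lam (lam + 1) / (#J σ²)` in the second. Minimizing `ρ lam (lam + 1) - lam ε` over `lam` yields
the explicit parameters (`isDP_of_momentBound_le`). -/

/-! ### Exponential moments of the privacy loss -/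

/-- `B` is the `lam`-th exponential moment of the privacy loss of `P` against `Q`, witnessed by a
density: `P` has a measurable density `f` with respect to `Q`, and `E_P [f ^ lam] = B`, written as
the integral of `f ^ (lam + 1)` against `Q`. -/
def HasDensityMoment {O : Type*} [MeasurableSpace O] (P Q : Measure O) (lam : ℝ) (B : ℝ≥0∞) :
    Prop :=
  ∃ f : O → ℝ≥0∞, Measurable f ∧ P = Q.withDensity f ∧ ∫⁻ o, f o ^ (lam + 1) ∂Q = B

namespace HasDensityMoment

variable {O : Type*} [MeasurableSpace O] {P Q : Measure O} {lam : ℝ} {B : ℝ≥0∞}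

theorem absolutelyContinuous (h : HasDensityMoment P Q lam B) : P ≪ Q := by
  obtain ⟨f, -, rfl, -⟩ := h
  exact withDensity_absolutelyContinuous Q f

theorem lintegral_rpow {f : O → ℝ≥0∞} (hf : Measurable f) (hlam : 0 < lam) :
    ∫⁻ o, f o ^ lam ∂(Q.withDensity f) = ∫⁻ o, f o ^ (lam + 1) ∂Q := by
  rw [lintegral_withDensity_eq_lintegral_mul _ hf (hf.pow_const _)]
  refine lintegral_congr fun o => ?_
  rw [ENNReal.rpow_add_of_nonneg _ _ hlam.le zero_le_one, ENNReal.rpow_one, mul_comm]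
  rfl

theorem logMoment_eq [SigmaFinite Q] (h : HasDensityMoment P Q lam B) (hlam : 0 < lam) :
    logMoment P Q lam = ENNReal.log B := by
  have hac := h.absolutelyContinuous
  obtain ⟨f, hf, rfl, rfl⟩ := h
  rw [logMoment, if_pos hac, ← lintegral_rpow hf hlam]
  congr 1
  refine lintegral_congr_ae ?_
  filter_upwards [hac.ae_le (Measure.rnDeriv_withDensity Q hf)] with o ho
  rw [ho]

theorem of_absolutelyContinuous [IsFiniteMeasure P] [IsFiniteMeasure Q] (h : P ≪ Q)
    (hlam : 0 < lam) : HasDensityMoment P Q lam (EReal.exp (logMoment P Q lam)) := by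
  have h' : HasDensityMoment P Q lam (∫⁻ o, P.rnDeriv Q o ^ (lam + 1) ∂Q) :=
    ⟨_, Measure.measurable_rnDeriv P Q, (Measure.withDensity_rnDeriv_eq P Q h).symm, rfl⟩
  rwa [h'.logMoment_eq hlam, ENNReal.exp_log]

theorem of_logMoment_ne_top [IsFiniteMeasure P] [IsFiniteMeasure Q] (h : logMoment P Q lam ≠ ⊤)
    (hlam : 0 < lam) : HasDensityMoment P Q lam (EReal.exp (logMoment P Q lam)) := by
  refine of_absolutelyContinuous ?_ hlam
  by_contra hac
  exact h (if_neg hac)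

theorem refl [IsProbabilityMeasure Q] : HasDensityMoment Q Q lam 1 :=
  ⟨1, measurable_one, withDensity_one.symm, by simp⟩

/-- Transport along a map with a measurable left inverse keeps the privacy loss. -/
theorem map {O' : Type*} [MeasurableSpace O'] (h : HasDensityMoment P Q lam B) {φ : O → O'}
    {ψ : O' → O} (hφ : Measurable φ) (hψ : Measurable ψ) (hψφ : Function.LeftInverse ψ φ) :
    HasDensityMoment (P.map φ) (Q.map φ) lam B := by
  obtain ⟨f, hf, rfl, rfl⟩ := h
  refine ⟨f ∘ ψ, hf.comp hψ, ?_, ?_⟩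
  · ext s hs
    rw [Measure.map_apply hφ hs, withDensity_apply _ (hφ hs), withDensity_apply _ hs,
      setLIntegral_map hs (hf.comp hψ) hφ]
    simp [hψφ _]
  · rw [lintegral_map ((hf.comp hψ).pow_const _) hφ]
    simp [hψφ _]

theorem _root_.MeasureTheory.lintegral_pi_prod {κ : Type*} [Fintype κ] {E : κ → Type*}
    [∀ i, MeasurableSpace (E i)] (μ : ∀ i, Measure (E i)) [∀ i, IsProbabilityMeasure (μ i)]
    {f : ∀ i, E i → ℝ≥0∞} (hf : ∀ i, Measurable (f i)) :
    ∫⁻ x, ∏ i, f i (x i) ∂(Measure.pi μ) = ∏ i, ∫⁻ x, f i x ∂(μ i) := by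
  refine (lintegral_prod_eq_prod_lintegral_of_indepFun Finset.univ
    (fun i (x : ∀ i, E i) => f i (x i)) (iIndepFun_pi fun i => (hf i).aemeasurable)
    fun i => (hf i).comp (measurable_pi_apply i)).trans ?_
  exact Finset.prod_congr rfl fun i _ => (measurePreserving_eval μ i).lintegral_comp (hf i)

/-- The exponential moments of independent mechanisms multiply. -/
theorem pi {κ : Type*} [Fintype κ] {E : κ → Type*} [∀ i, MeasurableSpace (E i)]
    {P Q : ∀ i, Measure (E i)} [∀ i, IsProbabilityMeasure (P i)] [∀ i, IsProbabilityMeasure (Q i)]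
    {B : κ → ℝ≥0∞} (hlam : 0 < lam) (h : ∀ i, HasDensityMoment (P i) (Q i) lam (B i)) :
    HasDensityMoment (Measure.pi P) (Measure.pi Q) lam (∏ i, B i) := by
  choose f hf hP hB using h
  refine ⟨fun x => ∏ i, f i (x i), by fun_prop, ?_, ?_⟩
  · refine Measure.pi_eq fun s hs => ?_
    rw [withDensity_apply _ (MeasurableSet.univ_pi hs),
      ← lintegral_indicator (MeasurableSet.univ_pi hs)]
    have : ∀ x, (Set.univ.pi s).indicator (fun x => ∏ i, f i (x i)) x
        = ∏ i, (s i).indicator (f i) (x i) := fun x => by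
      by_cases hx : x ∈ Set.univ.pi s
      · rw [Set.indicator_of_mem hx]
        exact Finset.prod_congr rfl fun i _ => (Set.indicator_of_mem (hx i trivial) _).symm
      · rw [Set.indicator_of_notMem hx]
        simp only [Set.mem_pi, Set.mem_univ, true_imp_iff, not_forall] at hx
        obtain ⟨i, hi⟩ := hx
        exact (Finset.prod_eq_zero (Finset.mem_univ i) (Set.indicator_of_notMem hi _)).symm
    simp_rw [this]
    rw [lintegral_pi_prod Q fun i => (hf i).indicator (hs i)]
    refine Finset.prod_congr rfl fun i _ => ?_
    rw [lintegral_indicator (hs i), hP i, withDensity_apply _ (hs i)]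
  · have : ∀ x : ∀ i, E i, (∏ i, f i (x i)) ^ (lam + 1) = ∏ i, f i (x i) ^ (lam + 1) := fun x =>
      (ENNReal.prod_rpow_of_nonneg (by positivity)).symm
    simp_rw [this]
    rw [lintegral_pi_prod Q fun i => (hf i).pow_const _]
    exact Finset.prod_congr rfl fun i _ => hB i

/-- The exponential moments of a mixture are at most the mixture of the exponential moments.
This is convexity of `u ↦ u ^ (lam + 1)`, applied pointwise to the density of the mixture, which is
the mean of the densities of the components under their posterior weights. -/
theorem mixture {κ : Type*} [Fintype κ] {P Q : κ → Measure O} [∀ i, IsFiniteMeasure (Q i)]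
    {B : κ → ℝ≥0∞} (w : κ → ℝ≥0∞) (hw : ∀ i, w i ≠ ∞) (hlam : 0 < lam)
    (h : ∀ i, HasDensityMoment (P i) (Q i) lam (B i)) :
    ∃ B' ≤ ∑ i, w i * B i,
      HasDensityMoment (∑ i, w i • P i) (∑ i, w i • Q i) lam B' := by
  choose f hf hP hB using h
  set ν : Measure O := ∑ i, w i • Q i with hν
  have hfin : ∀ i, IsFiniteMeasure (w i • Q i) := fun i => Measure.smul_finite _ (hw i)
  have : IsFiniteMeasure ν := by rw [hν]; infer_instance
  have hle : ∀ i, w i • Q i ≤ ν := fun i =>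
    Finset.single_le_sum (f := fun i => w i • Q i) (fun _ _ => Measure.zero_le _)
      (Finset.mem_univ i)
  -- the posterior weights of the components
  set q : κ → O → ℝ≥0∞ := fun i => (w i • Q i).rnDeriv ν
  have hq : ∀ i, Measurable (q i) := fun i => Measure.measurable_rnDeriv _ _
  have hqν : ∀ i, ν.withDensity (q i) = w i • Q i := fun i =>
    Measure.withDensity_rnDeriv_eq _ _ (Measure.absolutelyContinuous_of_le (hle i))
  have hsum : ∀ (u : κ → O → ℝ≥0∞), (∀ i, Measurable (u i)) →
      ν.withDensity (fun o => ∑ i, u i o) = ∑ i, ν.withDensity (u i) := fun u hu => by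
    ext s hs
    rw [withDensity_apply _ hs, lintegral_finsetSum _ fun i _ => hu i, Measure.coe_finsetSum,
      Finset.sum_apply]
    exact Finset.sum_congr rfl fun i _ => (withDensity_apply _ hs).symm
  have hone : ∀ᵐ o ∂ν, ∑ i, q i o = 1 := by
    have : ν.withDensity (fun o => ∑ i, q i o) = ν.withDensity 1 := by
      rw [hsum q hq, withDensity_one]
      exact Finset.sum_congr rfl fun i _ => hqν i
    exact (withDensity_eq_iff_of_sigmaFinite (by fun_prop) (by fun_prop)).1 this
  refine ⟨_, ?_, fun o => ∑ i, q i o * f i o, by fun_prop, ?_, rfl⟩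
  · calc ∫⁻ o, (∑ i, q i o * f i o) ^ (lam + 1) ∂ν
        ≤ ∫⁻ o, ∑ i, q i o * f i o ^ (lam + 1) ∂ν := by
          refine lintegral_mono_ae ?_
          filter_upwards [hone] with o ho
          exact ENNReal.rpow_arith_mean_le_arith_mean_rpow _ _ _ ho (by linarith)
      _ = ∑ i, w i * B i := by
          rw [lintegral_finsetSum _ fun i _ => by fun_prop]
          refine Finset.sum_congr rfl fun i _ => ?_
          rw [← hB i, ← smul_eq_mul, ← lintegral_smul_measure, ← hqν i,
            lintegral_withDensity_eq_lintegral_mul _ (hq i) (by fun_prop)]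
          rfl
  · refine Eq.trans ?_ (hsum (fun i o => q i o * f i o) fun i => (hq i).mul (hf i)).symm
    refine Finset.sum_congr rfl fun i _ => ?_
    rw [hP i, ← withDensity_smul_measure, ← hqν i]
    exact (withDensity_mul ν (hq i) (hf i)).symm

/-- Adaptive composition: if every conditional law of the second mechanism has exponential moment
at most `M`, then composing with it multiplies the exponential moment by at most `M`. -/
theorem compProd {H : Type*} [MeasurableSpace H] [MeasurableSpace.CountableOrCountablyGenerated H O]
    {P Q : Measure H} [IsFiniteMeasure Q] {K K' : Kernel H O} [IsFiniteKernel K]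
    [IsFiniteKernel K'] {B M : ℝ≥0∞} (hlam : 0 < lam) (h : HasDensityMoment P Q lam B)
    (hK : ∀ a, ∃ M' ≤ M, HasDensityMoment (K a) (K' a) lam M') :
    ∃ B' ≤ B * M, HasDensityMoment (P.compProd K) (Q.compProd K') lam B' := by
  obtain ⟨f, hf, rfl, rfl⟩ := h
  have hac : ∀ a, K a ≪ K' a := fun a => by
    obtain ⟨_, -, ha⟩ := hK a
    exact ha.absolutelyContinuous
  set k : H → O → ℝ≥0∞ := K.rnDeriv K'
  have hk : Measurable fun x : H × O => k x.1 x.2 := K.measurable_rnDeriv K'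
  have hk' : ∀ a, Measurable (k a) := fun a => hk.comp measurable_prodMk_left
  have hKk : ∀ a, K a = (K' a).withDensity (k a) := fun a => by
    rw [← Kernel.withDensity_apply _ hk, Kernel.withDensity_rnDeriv_eq (hac a)]
  have hM : ∀ a, ∫⁻ o, k a o ^ (lam + 1) ∂(K' a) ≤ M := fun a => by
    obtain ⟨M', hM', ha⟩ := hK a
    have hb : HasDensityMoment (K a) (K' a) lam _ := ⟨k a, hk' a, hKk a, rfl⟩
    have := (hb.logMoment_eq hlam).symm.trans (ha.logMoment_eq hlam)
    rw [ENNReal.log_injective this]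
    exact hM'
  refine ⟨_, ?_, fun x => f x.1 * k x.1 x.2, by fun_prop, ?_, rfl⟩
  · rw [Measure.lintegral_compProd (by fun_prop), ← lintegral_mul_const _ (by fun_prop)]
    refine lintegral_mono fun a => ?_
    simp only [ENNReal.mul_rpow_of_nonneg _ _ (show (0 : ℝ) ≤ lam + 1 by positivity)]
    rw [lintegral_const_mul _ ((hk' a).pow_const _)]
    gcongr
    exact hM a
  · ext s hs
    have : SFinite (Q.withDensity f) := inferInstance
    rw [Measure.compProd_apply hs, withDensity_apply _ hs, ← lintegral_indicator hs,
      Measure.lintegral_compProd ((by fun_prop : Measurable _).indicator hs),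
      lintegral_withDensity_eq_lintegral_mul _ hf (Kernel.measurable_kernel_prodMk_left hs)]
    refine lintegral_congr fun a => ?_
    have hsa : MeasurableSet (Prod.mk a ⁻¹' s) := measurable_prodMk_left hs
    rw [Pi.mul_apply, hKk a, withDensity_apply _ hsa, ← lintegral_indicator hsa,
      ← lintegral_const_mul _ ((hk' a).indicator hsa)]
    refine lintegral_congr fun o => ?_
    by_cases ho : (a, o) ∈ s
    · rw [Set.indicator_of_mem ho, Set.indicator_of_mem (show o ∈ Prod.mk a ⁻¹' s from ho)]
    · rw [Set.indicator_of_notMem ho,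
        Set.indicator_of_notMem (show o ∉ Prod.mk a ⁻¹' s from ho), mul_zero]

/-- The tail bound of the moments accountant: off the event that the density exceeds `exp ε`, the
law `P` is at most `exp ε` times `Q`, and Markov's inequality for the `lam`-th power of the density
bounds the probability of that event. -/
theorem measure_le (hlam : 0 < lam) (h : HasDensityMoment P Q lam B) (ε : ℝ) {S : Set O}
    (hS : MeasurableSet S) :
    P S ≤ ENNReal.ofReal (Real.exp ε) * Q S + B * ENNReal.ofReal (Real.exp (-(lam * ε))) := by
  obtain ⟨f, hf, rfl, rfl⟩ := h
  set c : ℝ≥0∞ := ENNReal.ofReal (Real.exp ε)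
  set T : Set O := {o | f o ≤ c}
  have hT : MeasurableSet T := measurableSet_le hf measurable_const
  have hc : c ^ lam * ENNReal.ofReal (Real.exp (-(lam * ε))) = 1 := by
    rw [ENNReal.ofReal_rpow_of_pos (Real.exp_pos _), ← ENNReal.ofReal_mul (by positivity),
      ← Real.exp_mul, ← Real.exp_add]
    simp [mul_comm]
  have hin : Q.withDensity f (S ∩ T) ≤ c * Q S := by
    rw [withDensity_apply _ (hS.inter hT)]
    calc ∫⁻ o in S ∩ T, f o ∂Q ≤ ∫⁻ _ in S ∩ T, c ∂Q :=
          setLIntegral_mono measurable_const fun o ho => ho.2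
      _ = c * Q (S ∩ T) := setLIntegral_const _ _
      _ ≤ c * Q S := by gcongr; exact Set.inter_subset_left
  have hout : Q.withDensity f (S \ T)
      ≤ (∫⁻ o, f o ^ (lam + 1) ∂Q) * ENNReal.ofReal (Real.exp (-(lam * ε))) := by
    rw [← lintegral_rpow hf hlam]
    set ν := Q.withDensity f
    calc ν (S \ T) ≤ ν {o | c ^ lam ≤ f o ^ lam} := by
          refine measure_mono fun o ho => ?_
          exact ENNReal.rpow_le_rpow (not_le.1 ho.2).le hlam.le
      _ = c ^ lam * ν {o | c ^ lam ≤ f o ^ lam} * ENNReal.ofReal (Real.exp (-(lam * ε))) := by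
          rw [mul_right_comm, hc, one_mul]
      _ ≤ _ := by
          gcongr
          exact mul_meas_ge_le_lintegral (hf.pow_const _) _
  calc Q.withDensity f S ≤ Q.withDensity f (S ∩ T) + Q.withDensity f (S \ T) :=
        measure_le_inter_add_sdiff _ _ _
    _ ≤ _ := add_le_add hin hout

end HasDensityMoment

/-! ### Normal laws -/

namespace HasDensityMoment

/-- The relative density of two normal laws with the same variance is log-linear, so its moments
are values of the moment generating function of a normal law. -/
theorem gaussianReal (a b : ℝ) {v : NNReal} (hv : v ≠ 0) (lam : ℝ) :
    HasDensityMoment (gaussianReal a v) (gaussianReal b v) lam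
      (ENNReal.ofReal (Real.exp (lam * (lam + 1) * (a - b) ^ 2 / (2 * v)))) := by
  have hv' : (v : ℝ) ≠ 0 := by exact_mod_cast hv
  refine ⟨fun x => ENNReal.ofReal (Real.exp ((a - b) * (2 * x - a - b) / (2 * v))), by fun_prop,
    ?_, ?_⟩
  · rw [gaussianReal_of_var_ne_zero a hv, gaussianReal_of_var_ne_zero b hv,
      ← withDensity_mul _ (measurable_gaussianPDF b v) (by fun_prop)]
    congr 1
    ext x
    simp only [gaussianPDF, gaussianPDFReal, Pi.mul_apply]
    rw [← ENNReal.ofReal_mul (by positivity), mul_assoc (√(2 * Real.pi * v))⁻¹, ← Real.exp_add]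
    congr 3
    field_simp
    ring
  · set t : ℝ := (lam + 1) * (a - b) / v
    have hpow : ∀ x : ℝ,
        ENNReal.ofReal (Real.exp ((a - b) * (2 * x - a - b) / (2 * v))) ^ (lam + 1)
          = ENNReal.ofReal (Real.exp (-(t * (a + b) / 2)) * Real.exp (t * x)) := fun x => by
      rw [ENNReal.ofReal_rpow_of_pos (Real.exp_pos _), ← Real.exp_mul, ← Real.exp_add]
      congr 2
      simp only [t]
      field_simp
      ring
    have hmgf : ∫ x, Real.exp (t * x) ∂(ProbabilityTheory.gaussianReal b v)
        = Real.exp (b * t + v * t ^ 2 / 2) :=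
      congrFun (mgf_fun_id_gaussianReal (μ := b) (v := v)) t
    simp_rw [hpow]
    rw [← ofReal_integral_eq_lintegral_ofReal ((integrable_exp_mul_gaussianReal t).const_mul _)
      (Filter.Eventually.of_forall fun x => by positivity), integral_const_mul, hmgf,
      ← Real.exp_add]
    congr 2
    simp only [t]
    field_simp
    ring

end HasDensityMoment

theorem multivariateGaussian_smul_one_eq_map {p : ℕ} (u : Grad p) (v : NNReal) :
    multivariateGaussian u ((v : ℝ) • (1 : Matrix (Fin p) (Fin p) ℝ))
      = (Measure.pi fun i => gaussianReal (u i) v).map (WithLp.toLp 2) := by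
  have hpos : ((v : ℝ) • (1 : Matrix (Fin p) (Fin p) ℝ)).PosSemidef :=
    Matrix.PosSemidef.one.smul v.2
  have : IsProbabilityMeasure ((Measure.pi fun i => gaussianReal (u i) v).map
      (WithLp.toLp 2 : (Fin p → ℝ) → Grad p)) :=
    Measure.isProbabilityMeasure_map (by fun_prop)
  refine Measure.ext_of_charFun ?_
  ext t
  simp_rw [charFun_multivariateGaussian hpos, charFun_pi, charFun_gaussianReal, ← Complex.exp_sum,
    PiLp.inner_apply]
  congr 1
  simp [Matrix.smul_mulVec, dotProduct, Finset.sum_div, Finset.sum_mul,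
    Finset.sum_sub_distrib]
  congr 1
  · refine Finset.sum_congr rfl fun i _ => by ring
  · refine Finset.sum_congr rfl fun i _ => by ring

theorem HasDensityMoment.multivariateGaussian {p : ℕ} (u w : Grad p) {v : ℝ} (hv : 0 < v) {lam : ℝ}
    (hlam : 0 < lam) :
    HasDensityMoment (multivariateGaussian u (v • (1 : Matrix (Fin p) (Fin p) ℝ)))
      (multivariateGaussian w (v • (1 : Matrix (Fin p) (Fin p) ℝ))) lam
      (ENNReal.ofReal (Real.exp (lam * (lam + 1) * ‖u - w‖ ^ 2 / (2 * v)))) := by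
  lift v to NNReal using hv.le
  have hv' : v ≠ 0 := by rintro rfl; exact lt_irrefl _ hv
  rw [multivariateGaussian_smul_one_eq_map, multivariateGaussian_smul_one_eq_map]
  have h := (HasDensityMoment.pi hlam
    fun i => HasDensityMoment.gaussianReal (u i) (w i) hv' lam).map
    (φ := (WithLp.toLp 2 : (Fin p → ℝ) → Grad p)) (ψ := WithLp.ofLp) (by fun_prop) (by fun_prop)
    fun _ => rfl
  convert h using 1
  rw [← ENNReal.ofReal_prod_of_nonneg fun i _ => by positivity, ← Real.exp_sum,
    EuclideanSpace.real_norm_sq_eq, Finset.mul_sum, Finset.sum_div]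
  rfl

/-! ### The update of one client -/

section ClientUpdate

variable {ι : Type*} {p : ℕ} {σ L : ℝ}

instance (J : Finset ι) (v : Grad p) : IsProbabilityMeasure (noisyUpdate σ L J v) := by
  unfold noisyUpdate
  split_ifs <;> infer_instance

theorem measurable_multivariateGaussian_mean (S : Matrix (Fin p) (Fin p) ℝ) :
    Measurable fun u : Grad p => multivariateGaussian u S := by
  unfold multivariateGaussian
  generalize Matrix.toEuclideanCLM (n := Fin p) (𝕜 := ℝ) _ = A
  refine Measure.measurable_of_measurable_coe _ fun s hs => ?_
  have hA : Measurable fun x : Grad p × Grad p => x.1 + A x.2 := by fun_prop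
  convert measurable_measure_prodMk_left (ν := stdGaussian (Grad p)) (hA hs) using 2 with u
  rw [Measure.map_apply (by fun_prop) hs]
  rfl

theorem measurable_noisyUpdate (J : Finset ι) :
    Measurable fun v : Grad p => noisyUpdate σ L J v := by
  unfold noisyUpdate
  split_ifs
  · exact measurable_const
  · exact measurable_multivariateGaussian_mean _

/-- For the empty batch the formula gives the value `1`, as it should. -/
theorem HasDensityMoment.noisyUpdate (hσ : 0 < σ) (hL : 0 < L) (J : Finset ι) (u w : Grad p)
    {lam : ℝ} (hlam : 0 < lam) :
    HasDensityMoment (noisyUpdate σ L J u) (noisyUpdate σ L J w) lam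
      (ENNReal.ofReal
        (Real.exp (lam * (lam + 1) * (J.card * ‖u - w‖ ^ 2) / (2 * (σ ^ 2 * L ^ 2))))) := by
  unfold _root_.noisyUpdate
  split_ifs with hJ
  · simpa [hJ] using HasDensityMoment.refl (Q := Measure.dirac (0 : Grad p)) (lam := lam)
  · have hcard : (0 : ℝ) < J.card := by
      exact_mod_cast Finset.card_pos.2 (Finset.nonempty_iff_ne_empty.2 hJ)
    convert HasDensityMoment.multivariateGaussian u w
      (show 0 < σ ^ 2 * L ^ 2 / (J.card : ℝ) by positivity) hlam using 3
    field_simp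

variable [Fintype ι]

instance (π : PMF (Finset ι)) (q : Finset ι → Grad p) :
    IsProbabilityMeasure (clientLaw σ L π q) := by
  refine ⟨?_⟩
  simp only [clientLaw, Measure.coe_finsetSum, Finset.sum_apply, Measure.smul_apply, measure_univ,
    smul_eq_mul, mul_one]
  rw [← tsum_fintype (L := .unconditional _)]
  exact π.tsum_coe

theorem measurable_clientLaw {H : Type*} [MeasurableSpace H] (π : PMF (Finset ι))
    {q : H → Finset ι → Grad p} (hq : ∀ J, Measurable fun h => q h J) :
    Measurable fun h => clientLaw σ L π (q h) := by
  refine Measure.measurable_of_measurable_coe _ fun s hs => ?_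
  simp only [clientLaw, Measure.coe_finsetSum, Finset.sum_apply, Measure.smul_apply, smul_eq_mul]
  refine Finset.measurable_sum _ fun J _ => Measurable.const_mul ?_ _
  exact (Measure.measurable_coe hs).comp ((measurable_noisyUpdate J).comp (hq J))

/-- The mixture bound for a client: only mini-batches that are drawn with positive probability
count, and an empty mini-batch releases nothing about the data. -/
theorem HasDensityMoment.clientLaw (hσ : 0 < σ) (hL : 0 < L) (π : PMF (Finset ι))
    (q q' : Finset ι → Grad p) {r : ℝ} (hr : 0 ≤ r)
    (hqq' : ∀ J ∈ π.support, J.Nonempty → J.card * ‖q J - q' J‖ ^ 2 ≤ 4 * L ^ 2 * r)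
    {lam : ℝ} (hlam : 0 < lam) :
    ∃ B ≤ ENNReal.ofReal (Real.exp (2 * r * lam * (lam + 1) / σ ^ 2)),
      HasDensityMoment (clientLaw σ L π q) (clientLaw σ L π q') lam B := by
  obtain ⟨B, hB, h⟩ := HasDensityMoment.mixture π π.apply_ne_top hlam
    fun J => HasDensityMoment.noisyUpdate hσ hL J (q J) (q' J) hlam
  refine ⟨B, hB.trans ?_, h⟩
  set K := ENNReal.ofReal (Real.exp (2 * r * lam * (lam + 1) / σ ^ 2))
  have hsum : ∑ J, π J = 1 := by
    rw [← tsum_fintype (L := .unconditional _)]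
    exact π.tsum_coe
  calc _ ≤ ∑ J, π J * K := by
        refine Finset.sum_le_sum fun J _ => ?_
        rcases eq_or_ne (π J) 0 with h0 | h0
        · simp [h0]
        · gcongr
          refine ENNReal.ofReal_le_ofReal (Real.exp_le_exp.2 ?_)
          have : J.card * ‖q J - q' J‖ ^ 2 ≤ 4 * L ^ 2 * r := by
            rcases J.eq_empty_or_nonempty with rfl | hJ
            · simpa using by positivity
            · exact hqq' J h0 hJ
          calc lam * (lam + 1) * (J.card * ‖q J - q' J‖ ^ 2) / (2 * (σ ^ 2 * L ^ 2))
              ≤ lam * (lam + 1) * (4 * L ^ 2 * r) / (2 * (σ ^ 2 * L ^ 2)) := by gcongr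
            _ = 2 * r * lam * (lam + 1) / σ ^ 2 := by field_simp; ring
    _ = K := by rw [← Finset.sum_mul, hsum, one_mul]

end ClientUpdate

/-! ### Differential privacy from log moments -/

section Accountant

variable {A D O : Type*} [MeasurableSpace O] {adj : D → D → Prop} {M : A → D → Measure O}

theorem logMoment_le_momentBound {lam : ℝ} (a : A) {d d' : D} (h : adj d d') :
    logMoment (M a d) (M a d') lam ≤ momentBound adj M lam :=
  le_iSup_of_le a <| le_iSup_of_le d <| le_iSup_of_le d' <| le_iSup_of_le h le_rfl

theorem momentBound_le {lam : ℝ} {b : EReal}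
    (h : ∀ a d d', adj d d' → logMoment (M a d) (M a d') lam ≤ b) : momentBound adj M lam ≤ b :=
  iSup_le fun a => iSup_le fun d => iSup_le fun d' => iSup_le fun hd => h a d d' hd

theorem measure_le_of_logMoment_le {P Q : Measure O} [IsFiniteMeasure P] [IsFiniteMeasure Q]
    {lam : ℝ} (hlam : 0 < lam) {b : EReal} (h : logMoment P Q lam ≤ b) (ε : ℝ) {S : Set O}
    (hS : MeasurableSet S) :
    P S ≤ ENNReal.ofReal (Real.exp ε) * Q S + EReal.exp (b - ((lam * ε : ℝ) : EReal)) := by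
  rcases eq_or_ne b ⊤ with rfl | hb
  · rw [EReal.top_sub_coe, EReal.exp_top, add_top]
    exact le_top
  · have hm := HasDensityMoment.of_logMoment_ne_top (ne_top_of_le_ne_top hb h) hlam
    refine (hm.measure_le hlam ε hS).trans ?_
    rw [sub_eq_add_neg, EReal.exp_add, ← EReal.coe_neg, EReal.exp_coe]
    gcongr

theorem isDP_accountantDelta [∀ a d, IsFiniteMeasure (M a d)] {α : ℝ → EReal}
    (h : ∀ lam, 0 < lam → momentBound adj M lam ≤ α lam) (a : A) (ε : ℝ) :
    IsDP adj (M a) ε (accountantDelta α ε) := by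
  intro d d' hd S hS
  rw [← tsub_le_iff_left]
  refine le_iInf fun lam => le_iInf fun hlam => tsub_le_iff_left.2 ?_
  exact measure_le_of_logMoment_le hlam ((logMoment_le_momentBound a hd).trans (h lam hlam)) ε hS

/-- The choice `lam = √(log (1 / δ) / ρ)` is optimal for log moments `ρ lam (lam + 1)`. It needs
`0 < ρ`; the case `ρ = 0` is the limit of positive values. -/
theorem isDP_of_momentBound_le [∀ a d, IsFiniteMeasure (M a d)] {ρ δ : ℝ} (hρ : 0 ≤ ρ) (hδ : 0 < δ)
    (hδ1 : δ < 1)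
    (h : ∀ lam, 0 < lam → momentBound adj M lam ≤ ((ρ * lam * (lam + 1) : ℝ) : EReal)) (a : A) :
    IsDP adj (M a) (ρ + 2 * Real.sqrt (ρ * Real.log (1 / δ))) (ENNReal.ofReal δ) := by
  intro d d' hd S hS
  set l := Real.log (1 / δ)
  have hl : 0 < l := Real.log_pos (by rw [lt_div_iff₀ hδ]; linarith)
  have hδl : δ = Real.exp (-l) := by
    rw [Real.exp_neg, Real.exp_log (by positivity), one_div, inv_inv]
  have key : ∀ ρ' : ℝ, ρ < ρ' → M a d S
      ≤ ENNReal.ofReal (Real.exp (ρ' + 2 * Real.sqrt (ρ' * l))) * M a d' S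
        + ENNReal.ofReal δ := by
    intro ρ' hρρ'
    have hρ' : 0 < ρ' := hρ.trans_lt hρρ'
    set lam := Real.sqrt (l / ρ')
    have hlam : 0 < lam := Real.sqrt_pos.2 (by positivity)
    have h1 : Real.sqrt (ρ' * l) = ρ' * lam := by
      rw [show ρ' * l = ρ' ^ 2 * (l / ρ') by field_simp, Real.sqrt_mul (by positivity),
        Real.sqrt_sq hρ'.le]
    have h2 : ρ' * lam ^ 2 = l := by
      rw [Real.sq_sqrt (by positivity)]
      field_simp
    have hb : logMoment (M a d) (M a d') lam ≤ ((ρ' * lam * (lam + 1) : ℝ) : EReal) := by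
      refine (logMoment_le_momentBound a hd).trans ((h lam hlam).trans ?_)
      exact EReal.coe_le_coe_iff.2 (by gcongr)
    convert measure_le_of_logMoment_le hlam hb (ρ' + 2 * Real.sqrt (ρ' * l)) hS using 2
    rw [← EReal.coe_sub, EReal.exp_coe, hδl, h1]
    congr 2
    linear_combination h2
  have hlim : Filter.Tendsto (fun ρ' : ℝ =>
      ENNReal.ofReal (Real.exp (ρ' + 2 * Real.sqrt (ρ' * l))) * M a d' S + ENNReal.ofReal δ)
      (nhdsWithin ρ (Set.Ioi ρ))
      (nhds (ENNReal.ofReal (Real.exp (ρ + 2 * Real.sqrt (ρ * l))) * M a d' S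
        + ENNReal.ofReal δ)) := by
    refine Filter.Tendsto.add (ENNReal.Tendsto.mul_const ?_ (Or.inr (measure_ne_top _ _)))
      tendsto_const_nhds
    refine ENNReal.tendsto_ofReal (Filter.Tendsto.mono_left ?_ nhdsWithin_le_nhds)
    exact Continuous.tendsto (by fun_prop) ρ
  exact ge_of_tendsto hlim (Filter.eventually_of_mem self_mem_nhdsWithin key)

end Accountant

/-! ### Rounds and transcripts -/

theorem measurable_measure_pi {H κ : Type*} [MeasurableSpace H] [Fintype κ] {E : κ → Type*}
    [∀ i, MeasurableSpace (E i)] {μ : ∀ i, H → Measure (E i)}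
    [∀ i h, IsProbabilityMeasure (μ i h)] (hμ : ∀ i, Measurable (μ i)) :
    Measurable fun h => Measure.pi fun i => μ i h := by
  refine Measurable.measure_of_isPiSystem_of_isProbabilityMeasure generateFrom_pi.symm
    isPiSystem_pi ?_
  rintro _ ⟨s, hs, rfl⟩
  simp_rw [Measure.pi_pi]
  exact Finset.measurable_prod _ fun i _ =>
    (Measure.measurable_coe (hs i trivial)).comp (hμ i)

section Federated

variable {C : Type*} {ι : C → Type*} {X : Type*} {p : ℕ} [∀ c, Fintype (ι c)]
  {σ L : ℝ} {π : ∀ c, PMF (Finset (ι c))} {Q : Query C ι X p}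

instance (t : ℕ) (c : C) (h : History C p t) (d : ι c → X) :
    IsProbabilityMeasure (clientMech σ L π Q t c h d) := by
  unfold clientMech
  infer_instance

theorem measurable_snoc (t : ℕ) : Measurable fun x : History C p t × (C → Grad p) =>
    (Fin.snoc (α := fun _ => C → Grad p) x.1 x.2 : History C p (t + 1)) := by
  refine measurable_pi_lambda _ fun i => ?_
  refine Fin.lastCases ?_ (fun j => ?_) i
  · simpa using measurable_snd
  · simp only [Fin.snoc_castSucc]
    exact (measurable_pi_apply j).comp measurable_fst

variable [Fintype C]

instance (t : ℕ) (h : History C p t) (D : ∀ c, ι c → X) :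
    IsProbabilityMeasure (roundMech σ L π Q t h D) := by
  unfold roundMech
  infer_instance

theorem measurable_roundMech (hQ : ∀ t c d J, Measurable fun h => Q t h c d J) (t : ℕ)
    (D : ∀ c, ι c → X) : Measurable fun h => roundMech σ L π Q t h D :=
  measurable_measure_pi (μ := fun c h => clientMech σ L π Q t c h (D c)) fun c =>
    measurable_clientLaw (π c) fun J => hQ t c (D c) J

variable (σ L π) in
/-- One round as a Markov kernel from the earlier releases to the new ones. -/
noncomputable def roundKernel (hQ : ∀ t c d J, Measurable fun h => Q t h c d J) (t : ℕ)
    (D : ∀ c, ι c → X) : Kernel (History C p t) (C → Grad p) :=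
  ⟨fun h => roundMech σ L π Q t h D, measurable_roundMech hQ t D⟩

instance (hQ : ∀ t c d J, Measurable fun h => Q t h c d J) (t : ℕ) (D : ∀ c, ι c → X) :
    IsMarkovKernel (roundKernel σ L π hQ t D) :=
  ⟨fun h => inferInstanceAs (IsProbabilityMeasure (roundMech σ L π Q t h D))⟩

theorem transcript_succ (hQ : ∀ t c d J, Measurable fun h => Q t h c d J) (D : ∀ c, ι c → X)
    (t : ℕ) [SFinite (transcript σ L π Q D t)] : transcript σ L π Q D (t + 1)
      = ((transcript σ L π Q D t).compProd (roundKernel σ L π hQ t D)).map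
          fun x => Fin.snoc (α := fun _ => C → Grad p) x.1 x.2 := by
  have hsnoc (h : History C p t) : Measurable fun o : C → Grad p =>
      (Fin.snoc (α := fun _ => C → Grad p) h o : History C p (t + 1)) :=
    (measurable_snoc t).comp measurable_prodMk_left
  have hpre (s : Set (History C p (t + 1))) (hs : MeasurableSet s) (h : History C p t) :
      (roundMech σ L π Q t h D).map (fun o => Fin.snoc (α := fun _ => C → Grad p) h o) s
        = roundKernel σ L π hQ t D h (Prod.mk h ⁻¹'
            ((fun x : History C p t × (C → Grad p) =>
              (Fin.snoc (α := fun _ => C → Grad p) x.1 x.2 : History C p (t + 1))) ⁻¹' s)) := by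
    rw [Measure.map_apply (hsnoc h) hs]
    rfl
  have hmeas : Measurable fun h : History C p t => (roundMech σ L π Q t h D).map
      fun o => (Fin.snoc (α := fun _ => C → Grad p) h o : History C p (t + 1)) := by
    refine Measure.measurable_of_measurable_coe _ fun s hs => ?_
    simp_rw [hpre s hs]
    exact Kernel.measurable_kernel_prodMk_left (measurable_snoc t hs)
  ext s hs
  rw [transcript, Measure.bind_apply hs hmeas.aemeasurable,
    Measure.map_apply (measurable_snoc t) hs, Measure.compProd_apply (measurable_snoc t hs)]
  exact lintegral_congr fun h => hpre s hs h

theorem isProbabilityMeasure_transcript (hQ : ∀ t c d J, Measurable fun h => Q t h c d J)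
    (D : ∀ c, ι c → X) (T : ℕ) : IsProbabilityMeasure (transcript σ L π Q D T) := by
  induction T with
  | zero => exact Measure.dirac.isProbabilityMeasure
  | succ t ih =>
    rw [transcript_succ hQ]
    exact Measure.isProbabilityMeasure_map (measurable_snoc t).aemeasurable

/-- Composition over rounds: bounds on the log moments of each round, uniform in the earlier
releases, add up. -/
theorem logMoment_transcript_le (hQ : ∀ t c d J, Measurable fun h => Q t h c d J)
    {D D' : ∀ c, ι c → X} {lam : ℝ} (hlam : 0 < lam)
    (hac : ∀ t h, roundMech σ L π Q t h D ≪ roundMech σ L π Q t h D') {b : ℕ → EReal}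
    (hb : ∀ t h, logMoment (roundMech σ L π Q t h D) (roundMech σ L π Q t h D') lam ≤ b t)
    (T : ℕ) :
    logMoment (transcript σ L π Q D T) (transcript σ L π Q D' T) lam
      ≤ ∑ t ∈ Finset.range T, b t := by
  have hprob := fun D T => isProbabilityMeasure_transcript (σ := σ) (L := L) (π := π) hQ D T
  have key : ∃ B ≤ EReal.exp (∑ t ∈ Finset.range T, b t),
      HasDensityMoment (transcript σ L π Q D T) (transcript σ L π Q D' T) lam B := by
    induction T with
    | zero => exact ⟨1, by simp, .refl (Q := Measure.dirac _)⟩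
    | succ t ih =>
      obtain ⟨B, hB, h⟩ := ih
      obtain ⟨B', hB', h'⟩ := h.compProd (K := roundKernel σ L π hQ t D)
        (K' := roundKernel σ L π hQ t D') (M := EReal.exp (b t)) hlam fun a =>
          ⟨_, EReal.exp_monotone (hb t a), .of_absolutelyContinuous (hac t a) hlam⟩
      refine ⟨B', ?_, ?_⟩
      · rw [Finset.sum_range_succ, EReal.exp_add]
        exact hB'.trans (by gcongr)
      · rw [transcript_succ hQ, transcript_succ hQ]
        refine h'.map (ψ := fun x => (Fin.init x, x (Fin.last t))) (measurable_snoc t) ?_ ?_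
        · exact (measurable_pi_lambda _ fun i => measurable_pi_apply _).prodMk
            (measurable_pi_apply _)
        · rintro ⟨h, o⟩
          simp
  obtain ⟨B, hB, h⟩ := key
  rw [h.logMoment_eq hlam, ← EReal.log_exp (∑ t ∈ Finset.range T, b t)]
  exact ENNReal.log_monotone hB

variable [DecidableEq C]

/-- Parallel composition: clients whose data agree contribute the factor `1`, so the privacy loss of
a round is that of the one client whose data differ. -/
theorem hasDensityMoment_roundMech {t : ℕ} {h : History C p t} {D D' : ∀ c, ι c → X} {c : C}
    {lam : ℝ} {B : ℝ≥0∞} (hlam : 0 < lam) (hD : ∀ c', c' ≠ c → D c' = D' c')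
    (hc : HasDensityMoment (clientMech σ L π Q t c h (D c)) (clientMech σ L π Q t c h (D' c))
      lam B) :
    HasDensityMoment (roundMech σ L π Q t h D) (roundMech σ L π Q t h D') lam B := by
  have := HasDensityMoment.pi (P := fun c => clientMech σ L π Q t c h (D c))
    (Q := fun c => clientMech σ L π Q t c h (D' c)) (B := fun c' => if c' = c then B else 1)
    hlam fun c' => by
      split_ifs with hcc
      · subst hcc
        exact hc
      · rw [hD c' hcc]
        exact .refl
  simpa [roundMech] using this

/-- All privacy claims hold for every query whose values, for adjacent data sets, are close on all
mini-batches that are drawn with positive probability. -/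
theorem privateAndTracked_of_sensitivity (hσ : 0 < σ) (hL : 0 < L)
    (hQ : ∀ t c d J, Measurable fun h => Q t h c d J) {r : C → ℝ} (hr : ∀ c, 0 ≤ r c)
    (hsens : ∀ t h c d d', ExampleAdj d d' → ∀ J ∈ (π c).support, J.Nonempty →
      J.card * ‖Q t h c d J - Q t h c d' J‖ ^ 2 ≤ 4 * L ^ 2 * r c) :
    PrivateAndTracked σ L π Q r := by
  have hclient : ∀ (t : ℕ) (h : History C p t) (c : C) (d d' : ι c → X) (lam : ℝ), 0 < lam →
      ExampleAdj d d' → ∃ B ≤ ENNReal.ofReal (Real.exp (2 * r c * lam * (lam + 1) / σ ^ 2)),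
        HasDensityMoment (clientMech σ L π Q t c h d) (clientMech σ L π Q t c h d') lam B :=
    fun t h c d d' lam hlam hd =>
      HasDensityMoment.clientLaw hσ hL (π c) _ _ (hr c) (hsens t h c d d' hd) hlam
  have hround : ∀ (t : ℕ) (h : History C p t) (c : C) (D D' : ∀ c, ι c → X) (lam : ℝ), 0 < lam →
      ExampleAdj (D c) (D' c) → (∀ c', c' ≠ c → D c' = D' c') →
      roundMech σ L π Q t h D ≪ roundMech σ L π Q t h D' ∧
      logMoment (roundMech σ L π Q t h D) (roundMech σ L π Q t h D') lam
        = logMoment (clientMech σ L π Q t c h (D c)) (clientMech σ L π Q t c h (D' c)) lam := by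
    intro t h c D D' lam hlam hd hD
    obtain ⟨B, -, hB⟩ := hclient t h c _ _ lam hlam hd
    have hR := hasDensityMoment_roundMech hlam hD hB
    exact ⟨hR.absolutelyContinuous, by rw [hB.logMoment_eq hlam, hR.logMoment_eq hlam]⟩
  have client_round : ∀ (t : ℕ) (c : C) (lam : ℝ), 0 < lam →
      momentBound ExampleAdj (clientMech σ L π Q t c) lam
        ≤ ((2 * r c * lam * (lam + 1) / σ ^ 2 : ℝ) : EReal) := by
    refine fun t c lam hlam => momentBound_le fun h d d' hd => ?_
    obtain ⟨B, hB, hm⟩ := hclient t h c d d' lam hlam hd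
    rw [hm.logMoment_eq hlam]
    refine (ENNReal.log_monotone hB).trans_eq ?_
    rw [ENNReal.log_ofReal_of_pos (Real.exp_pos _), Real.log_exp]
  have distributed_round : ∀ (t : ℕ) (lam : ℝ), 0 < lam →
      momentBound DistributedAdj (roundMech σ L π Q t) lam
        = ⨆ c, momentBound ExampleAdj (clientMech σ L π Q t c) lam := by
    refine fun t lam hlam => le_antisymm (momentBound_le ?_) (iSup_le fun c => momentBound_le ?_)
    · rintro h D D' ⟨c, hd, hD⟩
      rw [(hround t h c D D' lam hlam hd hD).2]
      exact le_iSup_of_le c (logMoment_le_momentBound h hd)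
    · intro h d d' hd
      obtain ⟨i, -⟩ := id hd
      -- the example `d i` fills the data sets of the other clients
      set D : ∀ c, ι c → X := fun _ _ => d i
      have hD : ∀ c', c' ≠ c → Function.update D c d c' = Function.update D c d' c' :=
        fun c' hc' => by simp [hc']
      have hd' : ExampleAdj (Function.update D c d c) (Function.update D c d' c) := by simpa using hd
      have := (hround t h c _ _ lam hlam hd' hD).2
      simp only [Function.update_self] at this
      rw [← this]
      exact logMoment_le_momentBound h ⟨c, hd', hD⟩
  have client_composition : ∀ (c : C) (T : ℕ) (lam : ℝ), 0 < lam →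
      momentBound ExampleAdj
          (fun (D : ∀ c, ι c → X) d => transcript σ L π Q (Function.update D c d) T) lam
        ≤ ∑ t ∈ Finset.range T, momentBound ExampleAdj (clientMech σ L π Q t c) lam := by
    refine fun c T lam hlam => momentBound_le fun D d d' hd => ?_
    have hD : ∀ c', c' ≠ c → Function.update D c d c' = Function.update D c d' c' :=
      fun c' hc' => by simp [hc']
    have hd' : ExampleAdj (Function.update D c d c) (Function.update D c d' c) := by simpa using hd
    refine logMoment_transcript_le hQ hlam
      (fun t h => (hround t h c _ _ lam hlam hd' hD).1) (fun t h => ?_) T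
    rw [(hround t h c _ _ lam hlam hd' hD).2]
    exact logMoment_le_momentBound h hd'
  have distributed_composition : ∀ (T : ℕ) (lam : ℝ), 0 < lam →
      momentBound DistributedAdj (fun (_ : Unit) D => transcript σ L π Q D T) lam
        ≤ ∑ t ∈ Finset.range T, momentBound DistributedAdj (roundMech σ L π Q t) lam := by
    refine fun T lam hlam => momentBound_le ?_
    rintro - D D' ⟨c, hd, hD⟩
    exact logMoment_transcript_le hQ hlam
      (fun t h => (hround t h c _ _ lam hlam hd hD).1)
      (fun t h => logMoment_le_momentBound h ⟨c, hd, hD⟩) T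
  have hprob := fun D T => isProbabilityMeasure_transcript (σ := σ) (L := L) (π := π) hQ D T
  have sum_le : ∀ (T : ℕ) (ρ s lam : ℝ) (b : ℕ → EReal), 0 < lam → s * T / σ ^ 2 ≤ ρ →
      (∀ t, b t ≤ ((s * lam * (lam + 1) / σ ^ 2 : ℝ) : EReal)) →
      ∑ t ∈ Finset.range T, b t ≤ ((ρ * lam * (lam + 1) : ℝ) : EReal) := by
    intro T ρ s lam b hlam hρ hb
    refine (Finset.sum_le_sum fun t _ => hb t).trans ?_
    rw [Finset.sum_const, Finset.card_range, ← EReal.coe_nsmul, EReal.coe_le_coe_iff, nsmul_eq_mul]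
    calc T * (s * lam * (lam + 1) / σ ^ 2) = s * T / σ ^ 2 * lam * (lam + 1) := by ring
      _ ≤ ρ * lam * (lam + 1) := by gcongr
  have hnonneg : ∀ c (T : ℕ), 0 ≤ 2 * r c * T / σ ^ 2 := fun c T => by
    have := hr c
    positivity
  refine ⟨client_round, distributed_round, client_composition, distributed_composition,
    ?_, ?_, ?_, ?_⟩
  · intro c T D ε
    exact isDP_accountantDelta
      (M := fun (D : ∀ c, ι c → X) d => transcript σ L π Q (Function.update D c d) T)
      (client_composition c T) D ε
  · intro T ε
    refine isDP_accountantDelta (M := fun (_ : Unit) D => transcript σ L π Q D T)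
      (fun lam hlam => (distributed_composition T lam hlam).trans_eq ?_) () ε
    exact Finset.sum_congr rfl fun t _ => distributed_round t lam hlam
  · intro c T D ρ δ hρ hδ hδ1
    exact isDP_of_momentBound_le
      (M := fun (D : ∀ c, ι c → X) d => transcript σ L π Q (Function.update D c d) T)
      (hρ ▸ hnonneg c T) hδ hδ1 (fun lam hlam => (client_composition c T lam hlam).trans <|
        sum_le T ρ (2 * r c) lam _ hlam hρ.ge fun t => client_round t c lam hlam) D
  · intro T ρ δ hρ hδ hδ1
    rintro D D' ⟨c₀, hDD'⟩
    -- adjacency provides a client, hence a client with the largest `r c`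
    obtain ⟨c, -, hc⟩ := Finset.exists_max_image Finset.univ r ⟨c₀, Finset.mem_univ c₀⟩
    refine isDP_of_momentBound_le (adj := DistributedAdj)
      (M := fun (_ : Unit) D => transcript σ L π Q D T)
      ((hnonneg c T).trans (hρ c)) hδ hδ1
      (fun lam hlam => (distributed_composition T lam hlam).trans <|
        sum_le T ρ (2 * r c) lam _ hlam (hρ c) fun t => ?_) () D D' ⟨c₀, hDD'⟩
    rw [distributed_round t lam hlam]
    refine iSup_le fun c' => (client_round t c' lam hlam).trans ?_
    have := hc c' (Finset.mem_univ c')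
    exact EReal.coe_le_coe_iff.2 (by gcongr)

end Federated

/-! ### Sensitivity of clipped gradients -/

theorem norm_clip_le {p : ℕ} {L : ℝ} (hL : 0 < L) (g : Grad p) : ‖clip L g‖ ≤ L := by
  have h1 : 0 < max 1 (‖g‖ / L) := lt_max_of_lt_left one_pos
  rw [clip, norm_smul, Real.norm_of_nonneg (by positivity), inv_mul_le_iff₀ h1]
  calc ‖g‖ = ‖g‖ / L * L := by field_simp
    _ ≤ max 1 (‖g‖ / L) * L := by gcongr; exact le_max_right _ _

theorem measurable_clip {p : ℕ} {L : ℝ} : Measurable (clip L : Grad p → Grad p) := by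
  unfold clip
  fun_prop

/-- Two averages of clipped gradients over the same batch differ in one summand only, whence by at
most `2 * L / #J`. -/
theorem norm_averaged_clip_sub_le {κ Y : Type*} {p : ℕ} {L : ℝ} (hL : 0 < L) (g : Y → Grad p)
    {d d' : κ → Y} (hd : ExampleAdj d d') (J : Finset κ) :
    ‖(J.card : ℝ)⁻¹ • ∑ i ∈ J, clip L (g (d i)) - (J.card : ℝ)⁻¹ • ∑ i ∈ J, clip L (g (d' i))‖
      ≤ (J.card : ℝ)⁻¹ * (2 * L) := by
  obtain ⟨i, hi⟩ := hd
  rw [← smul_sub, norm_smul, Real.norm_of_nonneg (by positivity), ← Finset.sum_sub_distrib]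
  gcongr
  by_cases hiJ : i ∈ J
  · rw [Finset.sum_eq_single_of_mem i hiJ fun j _ hj => by rw [hi j hj, sub_self]]
    linarith [norm_sub_le (clip L (g (d i))) (clip L (g (d' i))), norm_clip_le hL (g (d i)),
      norm_clip_le hL (g (d' i))]
  · rw [Finset.sum_eq_zero fun j hj => by rw [hi j (ne_of_mem_of_not_mem hj hiJ), sub_self],
      norm_zero]
    positivity

theorem theorem1 {C : Type*} [Fintype C] [DecidableEq C] {ι : C → Type*} [∀ c, Fintype (ι c)]
    {X : Type*} {p : ℕ} (σ L : ℝ) (hσ : 0 < σ) (hL : 0 < L)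
    (π : ∀ c, PMF (Finset (ι c))) (m n : C → ℕ) (hm : ∀ c, 1 ≤ m c)
    (hsize : ∀ c, ∀ J ∈ (π c).support, J.Nonempty → m c ≤ J.card ∧ J.card ≤ n c) :
    (∀ G : ∀ t : ℕ, History C p t → ∀ c : C, ∀ J : Finset (ι c), (J → X) → Grad p,
      (∀ t c J x, Measurable fun h => G t h c J x) →
      PrivateAndTracked σ L π (clippedGradient L G) (fun c => (n c : ℝ))) ∧
    (∀ g : ∀ t : ℕ, History C p t → C → X → Grad p,
      (∀ t c x, Measurable fun h => g t h c x) →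
      PrivateAndTracked σ L π (averagedClippedGradients L g) (fun c => 1 / (m c : ℝ))) := by
  constructor
  · intro G hG
    have hQ : ∀ t c d J, Measurable fun h => clippedGradient L G t h c d J := fun t c d J =>
      measurable_clip.comp (hG t c J fun i => d i)
    refine privateAndTracked_of_sensitivity hσ hL hQ (fun c => Nat.cast_nonneg _) ?_
    intro t h c d d' _ J hJ hJne
    have hn : (J.card : ℝ) ≤ n c := by exact_mod_cast (hsize c J hJ hJne).2
    have h2 : ‖clippedGradient L G t h c d J - clippedGradient L G t h c d' J‖ ≤ 2 * L := by
      refine (norm_sub_le _ _).trans ?_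
      rw [two_mul]
      exact add_le_add (norm_clip_le hL _) (norm_clip_le hL _)
    calc _ ≤ (n c : ℝ) * (2 * L) ^ 2 := by gcongr
      _ = _ := by ring
  · intro g hg
    have hQ : ∀ t (c : C) (d : ι c → X) J,
        Measurable fun h => averagedClippedGradients L g t h c d J := fun t c d J =>
      (Finset.measurable_sum J fun i _ => measurable_clip.comp (hg t c (d i))).const_smul
        (J.card : ℝ)⁻¹
    refine privateAndTracked_of_sensitivity hσ hL hQ (fun c => by positivity) ?_
    intro t h c d d' hd J hJ hJne
    have hm0 : (0 : ℝ) < m c := by exact_mod_cast hm c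
    have hmJ : (m c : ℝ) ≤ J.card := by exact_mod_cast (hsize c J hJ hJne).1
    have hJ0 : (0 : ℝ) < J.card := hm0.trans_le hmJ
    have h2 := norm_averaged_clip_sub_le hL (g t h c) hd J
    calc _ ≤ (J.card : ℝ) * ((J.card : ℝ)⁻¹ * (2 * L)) ^ 2 := by gcongr; exact h2
      _ = 4 * L ^ 2 * (1 / J.card) := by field_simp; ring
      _ ≤ 4 * L ^ 2 * (1 / m c) := by gcongr
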